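/- Let $\Omega$ be a nonempty set, $\mathbb K$ a nonempty set of maps $z:\mathbb R_{\ge 0}\to\Omega$, and $g:\Omega\to[0,1]$ a function such that $t\mapsto g(z(t))$ is Borel measurable for every $z\in\mathbb K$. For $T,\lambda>0$ and $z\in\mathbb K$ put $$v_T(z)=\frac1T\int_0^T g(z(t))\,dt,\qquad w_\lambda(z)=\lambda\int_0^\infty e^{-\lambda t}g(z(t))\,dt .$$ Let $\mathfrak U$ be the set of all bounded maps $\Omega\to\mathbb R$, and let $\mathfrak C$ be a set of maps $\mathbb K\to\mathbb R$ such that $Ac+B\in\mathfrak C$ whenever $c\in\mathfrak C$, $A\ge 0$, $B\in\mathbb R$, and such that $v_T,w_\lambda\in\mathfrak C$ for all $T,\lambda>0$. Let $V:\mathfrak C\to\mathfrak U$ be a game value map, that is, $V[Ac+B]=A\,V[c]+B$ for all $c\in\mathfrak C$, $A\ge 0$, $B\in\mathbb R$, and $V[c_1]\le V[c_2]$ pointwise on $\Omega$ whenever $c_1,c_2\in\mathfrak C$ and $c_1\le c_2$ pointwise on $\mathbb K$. For $U:\Omega\to\mathbb R$ and $h,T,\lambda>0$ define payoffs on $\mathbb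 K$ by $$\zeta^{U}_{h,T}(z)=\frac1{T+h}\int_0^h g(z(t))\,dt+\frac{T}{T+h}\,U(z(h)),\qquad \xi^{U}_{h,\lambda}(z)=\lambda\int_0^h e^{-\lambda t}g(z(t))\,dt+e^{-\lambda h}\,U(z(h)).$$ A family $U_T\in\mathfrak U$ $(T>0)$ is a subsolution (resp. supersolution) for the payoffs $v_T$ if for every $\varepsilon>0$ there is a positive integer $\bar T$ such that for all integers $h,T>\bar T$ one has $\zeta^{U_T}_{h,T}\in\mathfrak C$ and $U_{T+h}\le V[\zeta^{U_T}_{h,T}]+\varepsilon$ (resp. $U_{T+h}\ge V[\zeta^{U_T}_{h,T}]-\varepsilon$) on $\Omega$. A family $U_\lambda\in\mathfrak U$ $(\lambda>0)$ is a subsolution (resp. supersolution) for the payoffs $w_\lambda$ if for every $\varepsilon>0$ there is a positive integer $\bar T$ such that for all integers $h>\bar T$ and all real $\lambda\in(0,1/\bar T)$ one has $\xi^{U_\lambda}_{h,\lambda}\in\mathfrak C$ and $U_\lambda\le V[\xi^{U_\lambda}_{h,\lambda}]+\varepsilon$ (resp. $U_\lambda\ge V[\xi^{U_\lambda}_{h,\lambda}]-\varepsilon$)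 on $\Omega$. Assume that both payoff families satisfy the weak Dynamic Programming Principle: $V[v_T]$ $(T>0)$ is both a subsolution and a supersolution for the payoffs $v_T$, and $V[w_\lambda]$ $(\lambda>0)$ is both a subsolution and a supersolution for the payoffs $w_\lambda$. Then the following two statements are equivalent: (i) $V[v_T]$ converges uniformly on $\Omega$ as $T\uparrow\infty$ ($T$ real); (ii) $V[w_\lambda]$ converges uniformly on $\Omega$ as $\lambda\downarrow 0$. Moreover, when at least one of them holds, $\lim_{T\uparrow\infty}V[v_T](\omega)=\lim_{\lambda\downarrow 0}V[w_\lambda](\omega)$ for all $\omega\in\Omega$. -/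

import Mathlib

open Filter Topology
open scoped NNReal

namespace GameValue

/-- The positive real numbers, indexing the families `(v_T)_{T>0}` and `(w_lambda)_{lambda>0}`. -/
abbrev PosReal : Type := {x : ℝ // 0 < x}

/-- A positive natural number, regarded as a positive real number. -/
def natPos (n : ℕ+) : PosReal := ⟨(n : ℝ), Nat.cast_pos.mpr n.pos⟩

/-- The set of all bounded maps from `Ω` to `ℝ`. -/
def boundedMaps (Ω : Type*) : Set (Ω → ℝ) := {u | ∃ M : ℝ, ∀ ω, |u ω| ≤ M}

section Payoffs

variable {Ω : Type*} (K : Set (ℝ≥0 → Ω)) (g : Ω → ℝ)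

/-- The time average `v_T(z) = (1/T) ∫_0^T g(z(t)) dt`. -/
noncomputable def cesaro (T : PosReal) : K → ℝ := fun z =>
  (1 / (T : ℝ)) * ∫ t in (0 : ℝ)..T, g (z.1 t.toNNReal)

/-- The discounted average `w_lam(z) = lam ∫_0^∞ e^{-lam t} g(z(t)) dt`. -/
noncomputable def abel (lam : PosReal) : K → ℝ := fun z =>
  (lam : ℝ) * ∫ t in Set.Ioi (0 : ℝ), Real.exp (-(lam : ℝ) * t) * g (z.1 t.toNNReal)

/-- The payoff `z ↦ (1/(T+h)) ∫_0^h g(z(t)) dt + (T/(T+h)) U(z(h))`. -/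
noncomputable def zeta (U : Ω → ℝ) (h T : PosReal) : K → ℝ := fun z =>
  (1 / ((T : ℝ) + h)) * (∫ t in (0 : ℝ)..h, g (z.1 t.toNNReal))
    + ((T : ℝ) / (T + h)) * U (z.1 (h : ℝ).toNNReal)

/-- The payoff `z ↦ lam ∫_0^h e^{-lam t} g(z(t)) dt + e^{-lam h} U(z(h))`. -/
noncomputable def xi (U : Ω → ℝ) (h lam : PosReal) : K → ℝ := fun z =>
  (lam : ℝ) * (∫ t in (0 : ℝ)..h, Real.exp (-(lam : ℝ) * t) * g (z.1 t.toNNReal))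
    + Real.exp (-(lam : ℝ) * h) * U (z.1 (h : ℝ).toNNReal)

end Payoffs

section Values

variable {Ω : Type*} {K : Set (ℝ≥0 → Ω)}

/-- `A c + B ∈ C` whenever `c ∈ C`, `A ≥ 0` and `B ∈ ℝ`. -/
def IsAffineClosed (C : Set (K → ℝ)) : Prop :=
  ∀ c ∈ C, ∀ A B : ℝ, 0 ≤ A → (fun z => A * c z + B) ∈ C

/-- A game value map: `V[A c + B] = A V[c] + B` for `A ≥ 0`, and `V` is monotone. -/
structure IsGameValueMap (C : Set (K → ℝ)) (V : C → boundedMaps Ω) : Prop where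
  affine : ∀ (c : C) (A B : ℝ), 0 ≤ A → ∀ hmem : (fun z => A * c.1 z + B) ∈ C,
    ∀ ω, (V ⟨fun z => A * c.1 z + B, hmem⟩).1 ω = A * (V c).1 ω + B
  mono : ∀ c₁ c₂ : C, (∀ z, c₁.1 z ≤ c₂.1 z) → ∀ ω, (V c₁).1 ω ≤ (V c₂).1 ω

variable (g : Ω → ℝ) (C : Set (K → ℝ)) (V : C → boundedMaps Ω)

/-- The family `U_T` is a subsolution for the payoffs `v_T`. -/
def IsCesaroSubsolution (U : PosReal → boundedMaps Ω) : Prop :=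
  ∀ ε : ℝ, 0 < ε → ∃ N : ℕ+, ∀ h T : ℕ+, N < h → N < T →
    ∃ hmem : zeta K g (U (natPos T)).1 (natPos h) (natPos T) ∈ C,
      ∀ ω, (U (natPos (T + h))).1 ω ≤ (V ⟨_, hmem⟩).1 ω + ε

/-- The family `U_T` is a supersolution for the payoffs `v_T`. -/
def IsCesaroSupersolution (U : PosReal → boundedMaps Ω) : Prop :=
  ∀ ε : ℝ, 0 < ε → ∃ N : ℕ+, ∀ h T : ℕ+, N < h → N < T →
    ∃ hmem : zeta K g (U (natPos T)).1 (natPos h) (natPos T) ∈ C,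
      ∀ ω, (V ⟨_, hmem⟩).1 ω - ε ≤ (U (natPos (T + h))).1 ω

/-- The family `U_lam` is a subsolution for the payoffs `w_lam`. -/
def IsAbelSubsolution (U : PosReal → boundedMaps Ω) : Prop :=
  ∀ ε : ℝ, 0 < ε → ∃ N : ℕ+, ∀ (h : ℕ+) (lam : PosReal), N < h → (lam : ℝ) < 1 / (N : ℝ) →
    ∃ hmem : xi K g (U lam).1 (natPos h) lam ∈ C,
      ∀ ω, (U lam).1 ω ≤ (V ⟨_, hmem⟩).1 ω + ε

/-- The family `U_lam` is a supersolution for the payoffs `w_lam`. -/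
def IsAbelSupersolution (U : PosReal → boundedMaps Ω) : Prop :=
  ∀ ε : ℝ, 0 < ε → ∃ N : ℕ+, ∀ (h : ℕ+) (lam : PosReal), N < h → (lam : ℝ) < 1 / (N : ℝ) →
    ∃ hmem : xi K g (U lam).1 (natPos h) lam ∈ C,
      ∀ ω, (V ⟨_, hmem⟩).1 ω - ε ≤ (U lam).1 ω

/-- The value functions `V[v_T]`. -/
noncomputable def cesaroValue (hv : ∀ T, cesaro K g T ∈ C) (T : PosReal) : boundedMaps Ω :=
  V ⟨cesaro K g T, hv T⟩

/-- The value functions `V[w_lam]`. -/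
noncomputable def abelValue (hw : ∀ lam, abel K g lam ∈ C) (lam : PosReal) : boundedMaps Ω :=
  V ⟨abel K g lam, hw lam⟩

/-- The payoffs `v_T` enjoy the weak Dynamic Programming Principle. -/
def CesaroWeakDPP (hv : ∀ T, cesaro K g T ∈ C) : Prop :=
  IsCesaroSubsolution g C V (cesaroValue g C V hv) ∧
    IsCesaroSupersolution g C V (cesaroValue g C V hv)

/-- The payoffs `w_lam` enjoy the weak Dynamic Programming Principle. -/
def AbelWeakDPP (hw : ∀ lam, abel K g lam ∈ C) : Prop :=
  IsAbelSubsolution g C V (abelValue g C V hw) ∧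
    IsAbelSupersolution g C V (abelValue g C V hw)

end Values

/-- The filter `lam ↓ 0` on the positive reals. -/
def toZero : Filter PosReal := comap Subtype.val (𝓝[>] (0 : ℝ))

end GameValue

namespace GameValue

/-! The idea is to compare one dynamic programming step of both families. The Cesàro step leads from
horizon `T` to `T + h`, while the Abel step leads from the value at `l` back to itself. For `l ≈
1/T` and `h ≈ δT` the two one-step payoffs have the same weights up to `O(δ^2)`, and the
continuation value carries the factor `T/(T+h) ≤ 1 - δ/2`. As `V` is nonexpansive in the sup norm, a
distance `d` between the values becomes at most `(1 - δ/2) d + O(δ^2)` (`exists_contraction`), and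
the fixed point of this map is `O(δ)`. If the Cesàro values converge, those at `T` and `T + h`
nearly coincide, so `d` is bounded by its own image and `d = O(δ)`. If the Abel values converge,
finitely many iterations bring the Cesàro values at large integers within `O(δ)` of the limit; real
horizons follow by rounding. -/

/-! ### Uniform versus exponential weights -/

/-- Comparison of the uniform and the exponential weights on `[0, h]`. -/
theorem abs_uniform_sub_exponential_le {φ : ℝ → ℝ} (hφ : Measurable φ)
    (h01 : ∀ t, φ t ∈ Set.Icc (0 : ℝ) 1) {h T l : ℝ} (hh : 0 < h) (hT : 0 < T) (hl : 1 / T ≤ l) :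
    |1 / (T + h) * (∫ t in (0 : ℝ)..h, φ t) - l * ∫ t in (0 : ℝ)..h, Real.exp (-l * t) * φ t|
      ≤ (l * h) ^ 2 + (l - 1 / T) * h := by
  have hl0 : 0 < l := lt_of_lt_of_le (by positivity) hl
  have hi : IntervalIntegrable φ MeasureTheory.volume 0 h := by
    refine (intervalIntegrable_const (c := (1 : ℝ))).mono_fun hφ.aestronglyMeasurable ?_
    filter_upwards with t
    have := h01 t
    rw [Real.norm_of_nonneg this.1]
    simpa using this.2
  have hi' : IntervalIntegrable (fun t => Real.exp (-l * t) * φ t) MeasureTheory.volume 0 h :=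
    hi.continuousOn_mul (by fun_prop)
  rw [← intervalIntegral.integral_const_mul, ← intervalIntegral.integral_const_mul,
    ← intervalIntegral.integral_sub (hi.const_mul _) (hi'.const_mul _), ← Real.norm_eq_abs]
  -- Both weights lie in `[l - E, l]`, where `E` is the right-hand side.
  have key : ∀ t ∈ Set.uIoc 0 h, ‖1 / (T + h) * φ t - l * (Real.exp (-l * t) * φ t)‖
      ≤ l * (l * h) + (l - 1 / T) := by
    intro t ht
    rw [Set.uIoc_of_le hh.le] at ht
    have e1 : Real.exp (-l * t) ≤ 1 := Real.exp_le_one_iff.mpr (by nlinarith [ht.1])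
    have e2 : 1 - l * h ≤ Real.exp (-l * t) := by
      nlinarith [Real.add_one_le_exp (-l * t), ht.2]
    have b1 : 1 / (T + h) ≤ 1 / T := one_div_le_one_div_of_le hT (by linarith)
    have b2 : 1 / T - l * (l * h) ≤ 1 / (T + h) := by
      have : 1 / T - 1 / (T + h) = 1 / T * (1 / (T + h)) * h := by field_simp; ring
      have : 1 / T * (1 / (T + h)) ≤ l * l := by gcongr; exact b1.trans hl
      nlinarith
    have hd : |1 / (T + h) - l * Real.exp (-l * t)| ≤ l * (l * h) + (l - 1 / T) := by
      have : 0 ≤ l * (l * h) := by positivity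
      rw [abs_le]
      constructor <;> nlinarith
    have : 1 / (T + h) * φ t - l * (Real.exp (-l * t) * φ t)
        = (1 / (T + h) - l * Real.exp (-l * t)) * φ t := by ring
    rw [this, norm_mul, Real.norm_eq_abs, Real.norm_of_nonneg (h01 t).1]
    exact (mul_le_of_le_one_right (abs_nonneg _) (h01 t).2).trans hd
  refine (intervalIntegral.norm_integral_le_of_norm_le_const key).trans (le_of_eq ?_)
  rw [sub_zero, abs_of_pos hh]
  ring

/-- Comparison of the weights `T / (T + h)` and `exp (-l h)` of the terminal payoffs. -/
theorem abs_terminal_weight_sub_le {h T l : ℝ} (hh : 0 < h) (hT : 0 < T) (hl : 1 / T ≤ l) :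
    |T / (T + h) - Real.exp (-l * h)| ≤ (l * h) ^ 2 + (l - 1 / T) * h := by
  have hl0 : 0 < l := lt_of_lt_of_le (by positivity) hl
  have h1 : 1 - l * h ≤ Real.exp (-l * h) := by linarith [Real.add_one_le_exp (-l * h)]
  -- Inverting `exp (l h) ≥ 1 + l h ≥ 1 + h/T` settles the sign of the difference.
  have h2 : Real.exp (-l * h) ≤ T / (T + h) := by
    have e : T / (T + h) = (1 + 1 / T * h)⁻¹ := by field_simp
    rw [neg_mul, Real.exp_neg, e]
    refine inv_anti₀ (by positivity) ?_
    have : 1 / T * h ≤ l * h := by gcongr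
    linarith [Real.add_one_le_exp (l * h)]
  have h3 : T / (T + h) ≤ 1 - 1 / T * h + (1 / T * h) ^ 2 := by
    rw [div_le_iff₀ (by positivity)]
    have : (1 - 1 / T * h + (1 / T * h) ^ 2) * (T + h) = T + h ^ 3 / T ^ 2 := by
      field_simp; ring
    rw [this]
    have : 0 ≤ h ^ 3 / T ^ 2 := by positivity
    linarith
  have h4 : (1 / T * h) ^ 2 ≤ (l * h) ^ 2 := by gcongr
  rw [abs_of_nonneg (by linarith)]
  linarith

/-! ### Bounds on the payoffs -/

section Payoffs

variable {Ω : Type*} {K : Set (ℝ≥0 → Ω)} {g : Ω → ℝ}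

theorem measurable_path (hmeas : ∀ z ∈ K, Measurable (fun t : ℝ≥0 => g (z t))) (z : K) :
    Measurable (fun t : ℝ => g (z.1 t.toNNReal)) :=
  (hmeas z.1 z.2).comp measurable_real_toNNReal

theorem intervalIntegrable_path (hg : ∀ ω, g ω ∈ Set.Icc (0 : ℝ) 1)
    (hmeas : ∀ z ∈ K, Measurable (fun t : ℝ≥0 => g (z t))) (z : K) (a b : ℝ) :
    IntervalIntegrable (fun t : ℝ => g (z.1 t.toNNReal)) MeasureTheory.volume a b := by
  refine (intervalIntegrable_const (c := (1 : ℝ))).mono_fun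
    (measurable_path hmeas z).aestronglyMeasurable ?_
  filter_upwards with t
  have := hg (z.1 t.toNNReal)
  rw [Real.norm_of_nonneg this.1]
  simpa using this.2

theorem integral_path_mem (hg : ∀ ω, g ω ∈ Set.Icc (0 : ℝ) 1)
    (hmeas : ∀ z ∈ K, Measurable (fun t : ℝ≥0 => g (z t))) (z : K) {a b : ℝ} (hab : a ≤ b) :
    (∫ t in a..b, g (z.1 t.toNNReal)) ∈ Set.Icc 0 (b - a) := by
  refine ⟨intervalIntegral.integral_nonneg hab fun t _ => (hg _).1, ?_⟩
  have := intervalIntegral.integral_mono_on hab (intervalIntegrable_path hg hmeas z a b)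
    (intervalIntegrable_const (c := (1 : ℝ))) fun t _ => (hg (z.1 t.toNNReal)).2
  simpa using this

theorem cesaro_mem_Icc (hg : ∀ ω, g ω ∈ Set.Icc (0 : ℝ) 1)
    (hmeas : ∀ z ∈ K, Measurable (fun t : ℝ≥0 => g (z t))) (T : PosReal) (z : K) :
    cesaro K g T z ∈ Set.Icc (0 : ℝ) 1 := by
  have hT : (0 : ℝ) < T := T.2
  obtain ⟨h0, h1⟩ := integral_path_mem hg hmeas z hT.le
  refine ⟨mul_nonneg (by positivity) h0, ?_⟩
  rw [cesaro, one_div, inv_mul_le_iff₀ hT]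
  linarith

theorem abel_mem_Icc (hg : ∀ ω, g ω ∈ Set.Icc (0 : ℝ) 1) (l : PosReal) (z : K) :
    abel K g l z ∈ Set.Icc (0 : ℝ) 1 := by
  have hl : (0 : ℝ) < l := l.2
  refine ⟨mul_nonneg hl.le (MeasureTheory.integral_nonneg fun t =>
    mul_nonneg (Real.exp_pos _).le (hg _).1), ?_⟩
  have h1 : ∫ t in Set.Ioi (0 : ℝ), Real.exp (-(l : ℝ) * t) * g (z.1 t.toNNReal)
      ≤ ∫ t in Set.Ioi (0 : ℝ), Real.exp (-(l : ℝ) * t) := by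
    refine MeasureTheory.integral_mono_of_nonneg ?_
      (integrableOn_exp_mul_Ioi (neg_lt_zero.mpr hl) 0) ?_
    · exact Eventually.of_forall fun t => mul_nonneg (Real.exp_pos _).le (hg _).1
    · exact Eventually.of_forall fun t => mul_le_of_le_one_right (Real.exp_pos _).le (hg _).2
  rw [integral_exp_mul_Ioi (neg_lt_zero.mpr hl)] at h1
  calc abel K g l z ≤ (l : ℝ) * (-Real.exp (-(l : ℝ) * 0) / -(l : ℝ)) := by
        unfold abel; gcongr
    _ = 1 := by simp [hl.ne']

/-- The dynamic programming hypothesis sees only integer horizons; this bound transfers the result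
to real ones. -/
theorem abs_cesaro_sub_le (hg : ∀ ω, g ω ∈ Set.Icc (0 : ℝ) 1)
    (hmeas : ∀ z ∈ K, Measurable (fun t : ℝ≥0 => g (z t))) {S T : PosReal}
    (hST : (S : ℝ) ≤ T) (z : K) :
    |cesaro K g S z - cesaro K g T z| ≤ 1 - S / T := by
  have hS : (0 : ℝ) < S := S.2
  have hT : (0 : ℝ) < T := T.2
  obtain ⟨h0, h1⟩ := integral_path_mem hg hmeas z hS.le
  obtain ⟨h2, h3⟩ := integral_path_mem hg hmeas z hST
  have hadd := intervalIntegral.integral_add_adjacent_intervals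
    (intervalIntegrable_path hg hmeas z 0 S) (intervalIntegrable_path hg hmeas z S T)
  unfold cesaro
  rw [← hadd]
  set I := ∫ t in (0 : ℝ)..S, g (z.1 t.toNNReal)
  set J := ∫ t in (S : ℝ)..T, g (z.1 t.toNNReal)
  have e1 : 1 / (S : ℝ) * I - 1 / (T : ℝ) * (I + J) = ((T - S) * (I / S) - J) / T := by
    field_simp; ring
  have e2 : 1 - (S : ℝ) / T = (T - S) / T := by field_simp
  have h4 : I / S ≤ 1 := by rw [div_le_one hS]; linarith
  have h5 : 0 ≤ I / S := by positivity
  rw [e1, e2, abs_div, abs_of_pos hT]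
  gcongr
  rw [abs_le]
  constructor <;> nlinarith

/-- Only the gap `U - W` gets the factor `T/(T+h) < 1`, the source of the contraction. The running
and the terminal weights each contribute one error term, hence the 2. -/
theorem abs_zeta_sub_xi_le (hg : ∀ ω, g ω ∈ Set.Icc (0 : ℝ) 1)
    (hmeas : ∀ z ∈ K, Measurable (fun t : ℝ≥0 => g (z t))) {U W : Ω → ℝ}
    (hW : ∀ ω, W ω ∈ Set.Icc (0 : ℝ) 1) {d : ℝ} (hd : ∀ ω, |U ω - W ω| ≤ d) {h T l : PosReal}
    (hl : 1 / (T : ℝ) ≤ l) (z : K) :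
    |zeta K g U h T z - xi K g W h l z|
      ≤ (T : ℝ) / (T + h) * d + 2 * (((l : ℝ) * h) ^ 2 + (l - 1 / T) * h) := by
  have hh : (0 : ℝ) < h := h.2
  have hT : (0 : ℝ) < T := T.2
  have h1 := abs_uniform_sub_exponential_le (measurable_path hmeas z) (fun t => hg _) hh hT hl
  have h2 := abs_terminal_weight_sub_le hh hT hl
  unfold zeta xi
  set a := 1 / ((T : ℝ) + h) * ∫ t in (0 : ℝ)..h, g (z.1 t.toNNReal)
  set b := (l : ℝ) * ∫ t in (0 : ℝ)..h, Real.exp (-(l : ℝ) * t) * g (z.1 t.toNNReal)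
  set ω := z.1 (h : ℝ).toNNReal
  set p := (T : ℝ) / (T + h) with hp
  set q := Real.exp (-(l : ℝ) * h)
  have hp0 : 0 ≤ p := by positivity
  have e : a + p * U ω - (b + q * W ω) = p * (U ω - W ω) + ((a - b) + (p - q) * W ω) := by ring
  have h3 : |p * (U ω - W ω)| ≤ p * d := by
    rw [abs_mul, abs_of_nonneg hp0]; exact mul_le_mul_of_nonneg_left (hd ω) hp0
  have h4 : |(p - q) * W ω| ≤ |p - q| := by
    rw [abs_mul, abs_of_nonneg (hW ω).1]
    exact mul_le_of_le_one_right (abs_nonneg _) (hW ω).2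
  rw [e]
  have := abs_add_le (p * (U ω - W ω)) ((a - b) + (p - q) * W ω)
  have := abs_add_le (a - b) ((p - q) * W ω)
  linarith

end Payoffs

/-! ### Game value maps and the contraction step -/

section Values

variable {Ω : Type*} {K : Set (ℝ≥0 → Ω)} {g : Ω → ℝ} {C : Set (K → ℝ)} {V : C → boundedMaps Ω}

/-- Monotonicity together with compatibility with constants makes `V` nonexpansive. -/
theorem IsGameValueMap.le_add (hV : IsGameValueMap C V) (hC : IsAffineClosed C) {c₁ c₂ : C}
    {E : ℝ} (h : ∀ z, c₁.1 z ≤ c₂.1 z + E) (ω : Ω) : (V c₁).1 ω ≤ (V c₂).1 ω + E := by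
  have hm := hC c₂.1 c₂.2 1 E zero_le_one
  have := hV.mono c₁ ⟨_, hm⟩ (fun z => by simpa using h z) ω
  rwa [hV.affine c₂ 1 E zero_le_one hm ω, one_mul] at this

theorem IsGameValueMap.abs_sub_le (hV : IsGameValueMap C V) (hC : IsAffineClosed C) {c₁ c₂ : C}
    {E : ℝ} (h : ∀ z, |c₁.1 z - c₂.1 z| ≤ E) (ω : Ω) : |(V c₁).1 ω - (V c₂).1 ω| ≤ E := by
  have h1 := hV.le_add hC (fun z => by linarith [(abs_le.1 (h z)).2] :
    ∀ z, c₁.1 z ≤ c₂.1 z + E) ω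
  have h2 := hV.le_add hC (fun z => by linarith [(abs_le.1 (h z)).1] :
    ∀ z, c₂.1 z ≤ c₁.1 z + E) ω
  exact abs_le.2 ⟨by linarith, by linarith⟩

theorem IsGameValueMap.mem_Icc (hV : IsGameValueMap C V) (hC : IsAffineClosed C) {c : C}
    (h : ∀ z, c.1 z ∈ Set.Icc (0 : ℝ) 1) (ω : Ω) : (V c).1 ω ∈ Set.Icc (0 : ℝ) 1 := by
  -- With `A = 0`, the constant payoff `B` has value `B`.
  have hm := fun B : ℝ => hC c.1 c.2 0 B le_rfl
  have hc := fun B : ℝ => hV.affine c 0 B le_rfl (hm B) ω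
  have h0 := hV.mono ⟨_, hm 0⟩ c (fun z => by simpa using (h z).1) ω
  have h1 := hV.mono c ⟨_, hm 1⟩ (fun z => by simpa using (h z).2) ω
  rw [hc] at h0 h1
  exact ⟨by simpa using h0, by simpa using h1⟩

/-- One step of dynamic programming for both payoff families at once. -/
theorem abs_cesaroValue_add_sub_abelValue_le (hg : ∀ ω, g ω ∈ Set.Icc (0 : ℝ) 1)
    (hmeas : ∀ z ∈ K, Measurable (fun t : ℝ≥0 => g (z t)))
    (hC : IsAffineClosed C) (hV : IsGameValueMap C V)
    (hv : ∀ T : PosReal, cesaro K g T ∈ C) (hw : ∀ l : PosReal, abel K g l ∈ C)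
    (hvDPP : CesaroWeakDPP g C V hv) (hwDPP : AbelWeakDPP g C V hw) {ε : ℝ} (hε : 0 < ε) :
    ∃ N : ℕ, 0 < N ∧ ∀ (h T : ℕ+) (l : PosReal), N < (h : ℕ) → N < (T : ℕ) →
      (l : ℝ) < 1 / (N : ℝ) → 1 / ((T : ℕ) : ℝ) ≤ l → ∀ d : ℝ,
      (∀ ω, |(cesaroValue g C V hv (natPos T)).1 ω - (abelValue g C V hw l).1 ω| ≤ d) →
      ∀ ω, |(cesaroValue g C V hv (natPos (T + h))).1 ω - (abelValue g C V hw l).1 ω|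
        ≤ ((T : ℕ) : ℝ) / ((T : ℕ) + (h : ℕ)) * d
          + 2 * (((l : ℝ) * (h : ℕ)) ^ 2 + (l - 1 / ((T : ℕ) : ℝ)) * (h : ℕ)) + 2 * ε := by
  obtain ⟨N₁, h₁⟩ := hvDPP.1 ε hε
  obtain ⟨N₂, h₂⟩ := hvDPP.2 ε hε
  obtain ⟨N₃, h₃⟩ := hwDPP.1 ε hε
  obtain ⟨N₄, h₄⟩ := hwDPP.2 ε hε
  set N : ℕ := N₁ + N₂ + N₃ + N₄ with hN
  have p₁ := N₁.pos
  have p₃ := N₃.pos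
  have p₄ := N₄.pos
  refine ⟨N, by omega, fun h T l hh hT hl hTl d hd ω => ?_⟩
  have hlt : ∀ (M : ℕ+) (n : ℕ+), (M : ℕ) ≤ N → N < (n : ℕ) → M < n := fun M n hM hn =>
    PNat.coe_lt_coe _ _ |>.1 (hM.trans_lt hn)
  have hlam : ∀ M : ℕ+, (M : ℕ) ≤ N → (l : ℝ) < 1 / ((M : ℕ) : ℝ) := fun M hM =>
    hl.trans_le (one_div_le_one_div_of_le (Nat.cast_pos.2 M.pos) (by exact_mod_cast hM))
  obtain ⟨m₁, k₁⟩ := h₁ h T (hlt _ _ (by omega) hh) (hlt _ _ (by omega) hT)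
  obtain ⟨m₂, k₂⟩ := h₂ h T (hlt _ _ (by omega) hh) (hlt _ _ (by omega) hT)
  obtain ⟨m₃, k₃⟩ := h₃ h l (hlt _ _ (by omega) hh) (hlam _ (by omega))
  obtain ⟨m₄, k₄⟩ := h₄ h l (hlt _ _ (by omega) hh) (hlam _ (by omega))
  have key := hV.abs_sub_le hC (c₁ := ⟨_, m₁⟩) (c₂ := ⟨_, m₃⟩)
    (fun z => abs_zeta_sub_xi_le hg hmeas (hV.mem_Icc hC (abel_mem_Icc hg l)) hd hTl z) ω
  have i₁ := k₁ ω
  have i₂ := k₂ ω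
  have i₃ := k₃ ω
  have i₄ := k₄ ω
  rw [abs_le] at key ⊢
  simp only [natPos] at key i₁ i₂ i₃ i₄ ⊢
  constructor <;> linarith [key.1, key.2]

/-- With `l` close to `1 / T` and `h` close to `δ T`, passing from `T` to `T + h` contracts the
distance between the two value functions, up to an error of order `δ ^ 2`. -/
theorem exists_contraction (hg : ∀ ω, g ω ∈ Set.Icc (0 : ℝ) 1)
    (hmeas : ∀ z ∈ K, Measurable (fun t : ℝ≥0 => g (z t)))
    (hC : IsAffineClosed C) (hV : IsGameValueMap C V)
    (hv : ∀ T : PosReal, cesaro K g T ∈ C) (hw : ∀ l : PosReal, abel K g l ∈ C)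
    (hvDPP : CesaroWeakDPP g C V hv) (hwDPP : AbelWeakDPP g C V hw) {δ : ℝ} (hδ : 0 < δ)
    (hδ1 : δ ≤ 1) :
    ∃ N : ℕ, ∀ (h T : ℕ+) (l : PosReal), N < (T : ℕ) → 1 / ((T : ℕ) : ℝ) ≤ l →
      (l : ℝ) - 1 / ((T : ℕ) : ℝ) ≤ l / ((T : ℕ) : ℝ) → δ * (T : ℕ) ≤ (h : ℕ) →
      ((h : ℕ) : ℝ) ≤ 2 * δ * (T : ℕ) → ∀ d : ℝ, 0 ≤ d →
      (∀ ω, |(cesaroValue g C V hv (natPos T)).1 ω - (abelValue g C V hw l).1 ω| ≤ d) →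
      ∀ ω, |(cesaroValue g C V hv (natPos (T + h))).1 ω - (abelValue g C V hw l).1 ω|
        ≤ (1 - δ / 2) * d + 42 * δ ^ 2 := by
  obtain ⟨N, hN0, hN⟩ := abs_cesaroValue_add_sub_abelValue_le hg hmeas hC hV hv hw hvDPP hwDPP
    (pow_pos hδ 2)
  -- Large enough that `h ≥ δT > N`, and, since `l T ≤ 2`, also `l < 1/N` and `l ≤ δ`.
  obtain ⟨M, hM⟩ := exists_nat_gt ((2 * N + 2) / δ)
  refine ⟨M, fun h T l hT hTl hlT hh₁ hh₂ d hd0 hd ω => ?_⟩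
  have hl0 : (0 : ℝ) < l := l.2
  have hT0 : (0 : ℝ) < (T : ℕ) := Nat.cast_pos.2 T.pos
  have hh0 : (0 : ℝ) < (h : ℕ) := Nat.cast_pos.2 h.pos
  have hNr : (0 : ℝ) < N := Nat.cast_pos.2 hN0
  set t : ℝ := ((T : ℕ) : ℝ) with ht
  set k : ℝ := ((h : ℕ) : ℝ) with hk
  have hMT : (M : ℝ) < t := by rw [ht]; exact_mod_cast hT
  have hδt : 2 * N + 2 < δ * t := by
    rw [div_lt_iff₀ hδ] at hM; nlinarith
  have htN : 2 * N + 2 < t := by nlinarith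
  have hlt : l * t ≤ 1 + l := by
    have := mul_le_mul_of_nonneg_right hlT hT0.le
    rw [sub_mul, one_div_mul_cancel hT0.ne', div_mul_cancel₀ _ hT0.ne'] at this
    linarith
  have hlt2 : l * t ≤ 2 := by nlinarith
  have hlN : (l : ℝ) < 1 / N := by
    rw [lt_div_iff₀ hNr]; nlinarith
  have step := hN h T l (Nat.cast_lt (α := ℝ).1 (by linarith))
    (Nat.cast_lt (α := ℝ).1 (by linarith)) hlN hTl d hd ω
  have hlk : l * k ≤ 4 * δ := by
    calc l * k ≤ l * (2 * δ * t) := by gcongr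
      _ = 2 * δ * (l * t) := by ring
      _ ≤ 2 * δ * 2 := by gcongr
      _ = 4 * δ := by ring
  have e1 : (l * k) ^ 2 ≤ 16 * δ ^ 2 := by
    calc (l * k) ^ 2 ≤ (4 * δ) ^ 2 := by gcongr
      _ = 16 * δ ^ 2 := by ring
  have hlδ : l ≤ δ := by nlinarith
  have e2 : (l - 1 / t) * k ≤ 2 * δ ^ 2 := by
    calc (l - 1 / t) * k ≤ l / t * (2 * δ * t) := by gcongr
      _ = 2 * δ * l := by field_simp
      _ ≤ 2 * δ * δ := by gcongr
      _ = 2 * δ ^ 2 := by ring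
  -- `t/(t+k) ≤ 1/(1+δ) ≤ 1 - δ/2`, the last inequality because `δ ≤ 1`. The errors sum to at most
  -- `2(16+2)δ^2 + 2δ^2 ≤ 42δ^2`.
  have e3 : t / (t + k) ≤ 1 - δ / 2 := by
    rw [div_le_iff₀ (by positivity)]
    nlinarith
  have e4 := mul_le_mul_of_nonneg_right e3 hd0
  nlinarith

/-! ### From Cesàro to Abel convergence -/

theorem abel_tendsto_of_cesaro_tendsto [Nonempty Ω] (hg : ∀ ω, g ω ∈ Set.Icc (0 : ℝ) 1)
    (hmeas : ∀ z ∈ K, Measurable (fun t : ℝ≥0 => g (z t)))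
    (hC : IsAffineClosed C) (hV : IsGameValueMap C V)
    (hv : ∀ T : PosReal, cesaro K g T ∈ C) (hw : ∀ l : PosReal, abel K g l ∈ C)
    (hvDPP : CesaroWeakDPP g C V hv) (hwDPP : AbelWeakDPP g C V hw) {f : Ω → ℝ}
    (hf : TendstoUniformly (fun T => (cesaroValue g C V hv T).1) f atTop) :
    TendstoUniformly (fun l => (abelValue g C V hw l).1) f toZero := by
  rw [Metric.tendstoUniformly_iff] at hf ⊢
  intro η hη
  obtain ⟨δ, hδ, hδ1, hδη⟩ : ∃ δ : ℝ, 0 < δ ∧ δ ≤ 1 ∧ 100 * δ < η :=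
    ⟨min 1 (η / 200), by positivity, min_le_left _ _, by linarith [min_le_right 1 (η / 200)]⟩
  have : Nonempty PosReal := ⟨⟨1, one_pos⟩⟩
  obtain ⟨T₀, hT₀⟩ := eventually_atTop.1 (hf (δ ^ 2) (by positivity))
  obtain ⟨N, hN⟩ := exists_contraction hg hmeas hC hV hv hw hvDPP hwDPP hδ hδ1
  have hb : 0 < min (1 / (T₀ : ℝ)) (min (1 / (N + 1)) δ) := by
    have := T₀.2
    positivity
  refine mem_comap.2 ⟨_, Ioo_mem_nhdsGT hb, fun l hl ω => ?_⟩
  have hl0 : (0 : ℝ) < l := l.2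
  have hl1 : (l : ℝ) < 1 / T₀ := hl.2.trans_le (min_le_left _ _)
  have hl2 : (l : ℝ) < 1 / (N + 1) := hl.2.trans_le ((min_le_right _ _).trans (min_le_left _ _))
  have hl3 : (l : ℝ) < δ := hl.2.trans_le ((min_le_right _ _).trans (min_le_right _ _))
  have hT₀p : (0 : ℝ) < T₀ := T₀.2
  have il0 : (0 : ℝ) < 1 / l := by positivity
  have i1 : (T₀ : ℝ) < 1 / l := by rwa [lt_one_div hT₀p hl0]
  have i2 : (N : ℝ) + 1 < 1 / l := by rwa [lt_one_div (by positivity) hl0]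
  have i3 : 1 < δ * (1 / l) := by rw [mul_one_div, one_lt_div hl0]; exact hl3
  -- Rounding up gives `1/T ≤ l` with `l T ≤ 1 + l`, the closeness that the contraction requires.
  let T : ℕ+ := ⟨⌈1 / (l : ℝ)⌉₊, Nat.ceil_pos.2 il0⟩
  have hTdef : (T : ℕ) = ⌈1 / (l : ℝ)⌉₊ := rfl
  have hT1 : 1 / (l : ℝ) ≤ (T : ℕ) := Nat.le_ceil _
  have hT2 : ((T : ℕ) : ℝ) < 1 / l + 1 := Nat.ceil_lt_add_one il0.le
  have hT0 : (0 : ℝ) < (T : ℕ) := Nat.cast_pos.2 T.pos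
  have hδT : 0 < δ * (T : ℕ) := by positivity
  let h : ℕ+ := ⟨⌈δ * ((T : ℕ) : ℝ)⌉₊, Nat.ceil_pos.2 hδT⟩
  have hh1 : δ * (T : ℕ) ≤ (h : ℕ) := Nat.le_ceil _
  have hh2 : ((h : ℕ) : ℝ) < δ * (T : ℕ) + 1 := Nat.ceil_lt_add_one hδT.le
  have hδT1 : 1 < δ * (T : ℕ) := i3.trans_le (by gcongr)
  have hlT : (l : ℝ) * (T : ℕ) ≤ 1 + l := by
    have := mul_le_mul_of_nonneg_left hT2.le hl0.le
    rw [mul_add, mul_one_div_cancel hl0.ne'] at this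
    linarith
  have hclose : (l : ℝ) - 1 / (T : ℕ) ≤ l / (T : ℕ) := by
    have : (l : ℝ) - 1 / (T : ℕ) = (l * (T : ℕ) - 1) / (T : ℕ) := by field_simp
    rw [this]
    gcongr
    linarith
  have hU1 := hT₀ (natPos T) (Subtype.coe_le_coe.1 (by
    change (T₀ : ℝ) ≤ (T : ℕ); linarith))
  have hU2 := hT₀ (natPos (T + h)) (Subtype.coe_le_coe.1 (by
    change (T₀ : ℝ) ≤ ((T + h : ℕ+) : ℕ)
    rw [PNat.add_coe, Nat.cast_add]
    linarith [(Nat.cast_nonneg (h : ℕ) : (0 : ℝ) ≤ (h : ℕ))]))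
  simp only [Real.dist_eq] at hU1 hU2 ⊢
  set W := (abelValue g C V hw l).1 with hWdef
  set U := (cesaroValue g C V hv (natPos T)).1 with hUdef
  set U' := (cesaroValue g C V hv (natPos (T + h))).1 with hU'def
  have hW01 : ∀ ω, W ω ∈ Set.Icc (0 : ℝ) 1 := hV.mem_Icc hC (abel_mem_Icc hg l)
  have hU01 : ∀ ω, U ω ∈ Set.Icc (0 : ℝ) 1 := hV.mem_Icc hC (cesaro_mem_Icc hg hmeas _)
  have hbdd : BddAbove (Set.range fun ω => |U ω - W ω|) := by
    refine ⟨1, ?_⟩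
    rintro _ ⟨ω, rfl⟩
    exact abs_le.2 ⟨by linarith [(hW01 ω).2, (hU01 ω).1], by linarith [(hW01 ω).1, (hU01 ω).2]⟩
  have hd : ∀ ω, |U ω - W ω| ≤ ⨆ ω, |U ω - W ω| := le_ciSup hbdd
  set d := ⨆ ω, |U ω - W ω| with hddef
  have hd0 : 0 ≤ d := (abs_nonneg _).trans (hd ω)
  have hN' : N < (T : ℕ) := by exact_mod_cast (by linarith : (N : ℝ) < (T : ℕ))
  have hstep := hN h T l hN' (by rwa [one_div_le hT0 hl0]) hclose hh1 (by linarith) d hd0 hd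
  -- The Cesàro values at `T` and `T + h` are both within `δ^2` of `f`, so returning from `T + h` to
  -- `T` adds `2δ^2` to `42δ^2`.
  have hd2 : d ≤ (1 - δ / 2) * d + 44 * δ ^ 2 := by
    refine ciSup_le fun ω => ?_
    have a1 := abs_lt.1 (hU1 ω)
    have a2 := abs_lt.1 (hU2 ω)
    have a3 := abs_le.1 (hstep ω)
    exact abs_le.2 ⟨by linarith [a1.1, a1.2, a2.1, a2.2, a3.1, a3.2],
      by linarith [a1.1, a1.2, a2.1, a2.2, a3.1, a3.2]⟩
  have hd3 : d ≤ 88 * δ := by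
    refine le_of_mul_le_mul_left ?_ (half_pos hδ)
    linarith
  have a1 := abs_lt.1 (hU1 ω)
  have a2 := abs_le.1 (hd ω)
  have : δ ^ 2 ≤ δ := by nlinarith
  exact abs_lt.2 ⟨by linarith [a1.1, a1.2, a2.1, a2.2], by linarith [a1.1, a1.2, a2.1, a2.2]⟩

/-! ### From Abel to Cesàro convergence -/

/-- If the Abel values converge to `f` and the Cesàro values at large integers are within `d`
of `f`, then the latter distance improves. -/
theorem exists_cesaroValue_improvement (hg : ∀ ω, g ω ∈ Set.Icc (0 : ℝ) 1)
    (hmeas : ∀ z ∈ K, Measurable (fun t : ℝ≥0 => g (z t)))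
    (hC : IsAffineClosed C) (hV : IsGameValueMap C V)
    (hv : ∀ T : PosReal, cesaro K g T ∈ C) (hw : ∀ l : PosReal, abel K g l ∈ C)
    (hvDPP : CesaroWeakDPP g C V hv) (hwDPP : AbelWeakDPP g C V hw) {f : Ω → ℝ}
    {δ : ℝ} (hδ : 0 < δ) (hδ1 : δ ≤ 1) {R : ℕ}
    (hf : ∀ T : ℕ+, R ≤ (T : ℕ) → ∀ l : PosReal, (l : ℝ) = 1 / (T : ℕ) →
      ∀ ω, |(abelValue g C V hw l).1 ω - f ω| ≤ δ ^ 2) {d : ℝ} (hd0 : 0 ≤ d)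
    (hd : ∀ T : ℕ+, R ≤ (T : ℕ) → ∀ ω, |(cesaroValue g C V hv (natPos T)).1 ω - f ω| ≤ d) :
    ∃ M : ℕ, ∀ T : ℕ+, M ≤ (T : ℕ) →
      ∀ ω, |(cesaroValue g C V hv (natPos T)).1 ω - f ω| ≤ (1 - δ / 2) * d + 44 * δ ^ 2 := by
  obtain ⟨N, hN⟩ := exists_contraction hg hmeas hC hV hv hw hvDPP hwDPP hδ hδ1
  obtain ⟨M, hM⟩ := exists_nat_gt ((R + N + 2) * (1 + δ) + 2 * ((1 + δ) / δ) * (1 + δ))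
  refine ⟨M, fun S hS => ?_⟩
  have hSM : (M : ℝ) ≤ (S : ℕ) := by exact_mod_cast hS
  have hδ' : 0 < 1 + δ := by linarith
  have hS0 : (0 : ℝ) < (S : ℕ) := Nat.cast_pos.2 S.pos
  set s : ℝ := ((S : ℕ) : ℝ) with hs
  have hq : (R + N + 2) + 2 * ((1 + δ) / δ) < s / (1 + δ) := by
    rw [lt_div_iff₀ hδ']
    linarith [(by ring : ((R + N + 2) + 2 * ((1 + δ) / δ)) * (1 + δ)
      = (R + N + 2) * (1 + δ) + 2 * ((1 + δ) / δ) * (1 + δ))]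
  have hr0 : 0 < (1 + δ) / δ := by positivity
  have hR0 : (0 : ℝ) ≤ R := Nat.cast_nonneg R
  have hN0 : (0 : ℝ) ≤ N := Nat.cast_nonneg N
  have hq0 : 0 ≤ s / (1 + δ) := by positivity
  have hT1 : ((⌊s / (1 + δ)⌋₊ : ℕ) : ℝ) ≤ s / (1 + δ) := Nat.floor_le hq0
  have hT2 : s / (1 + δ) < (⌊s / (1 + δ)⌋₊ : ℕ) + 1 := Nat.lt_floor_add_one _
  -- Split `S = n + h`. The floor gives `δn ≤ h < δn + 1 + δ`, and this is at most `2δn` once `n ≥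
  -- (1+δ)/δ`.
  set n : ℕ := ⌊s / (1 + δ)⌋₊ with hn
  have hn0 : 0 < n := by exact_mod_cast (by linarith : (0 : ℝ) < n)
  have hns : (n : ℝ) * (1 + δ) ≤ s := by rwa [le_div_iff₀ hδ'] at hT1
  have hsn : s < ((n : ℝ) + 1) * (1 + δ) := by rwa [div_lt_iff₀ hδ'] at hT2
  have hn0r : (0 : ℝ) < n := Nat.cast_pos.2 hn0
  have hnS : n < (S : ℕ) := by
    have : (n : ℝ) < s := by nlinarith
    rw [hs] at this
    exact_mod_cast this
  let T : ℕ+ := ⟨n, hn0⟩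
  let h : ℕ+ := ⟨(S : ℕ) - n, Nat.sub_pos_of_lt hnS⟩
  have hST : S = T + h := PNat.eq (by
    change (S : ℕ) = n + ((S : ℕ) - n)
    omega)
  have hTn : ((T : ℕ) : ℝ) = n := rfl
  have hhr : ((h : ℕ) : ℝ) = s - n := by
    change (((S : ℕ) - n : ℕ) : ℝ) = s - n
    rw [Nat.cast_sub hnS.le]
  let l : PosReal := ⟨1 / (n : ℝ), by positivity⟩
  have hl : (l : ℝ) = 1 / (T : ℕ) := rfl
  have hRT : R ≤ (T : ℕ) := by
    change R ≤ n
    exact_mod_cast (by linarith : (R : ℝ) ≤ n)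
  have hNT : N < (T : ℕ) := by
    change N < n
    exact_mod_cast (by linarith : (N : ℝ) < n)
  have hW := hf T hRT l hl
  have hU := hd T hRT
  have hδn : 1 + δ ≤ δ * n := by
    have : (1 + δ) / δ ≤ n := by linarith
    rw [div_le_iff₀ hδ] at this
    linarith
  have hstep := hN h T l hNT hl.ge (by rw [hl, sub_self]; positivity)
    (by rw [hTn, hhr]; linarith) (by rw [hTn, hhr]; linarith) (d + δ ^ 2) (by positivity)
    (fun ω => by
      have a1 := abs_le.1 (hW ω)
      have a2 := abs_le.1 (hU ω)
      exact abs_le.2 ⟨by linarith [a1.1, a1.2, a2.1, a2.2], by linarith [a1.1, a1.2, a2.1, a2.2]⟩)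
  intro ω
  rw [hST]
  have a1 := abs_le.1 (hW ω)
  have a3 := abs_le.1 (hstep ω)
  -- Replacing `f` by the Abel value and back costs `δ^2` each way: `42 + 1 + 1 = 44`.
  have : (1 - δ / 2) * (d + δ ^ 2) ≤ (1 - δ / 2) * d + δ ^ 2 := by
    have : 0 ≤ δ / 2 * δ ^ 2 := by positivity
    linarith
  exact abs_le.2 ⟨by linarith [a1.1, a1.2, a3.1, a3.2], by linarith [a1.1, a1.2, a3.1, a3.2]⟩

theorem cesaro_tendsto_of_abel_tendsto (hg : ∀ ω, g ω ∈ Set.Icc (0 : ℝ) 1)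
    (hmeas : ∀ z ∈ K, Measurable (fun t : ℝ≥0 => g (z t)))
    (hC : IsAffineClosed C) (hV : IsGameValueMap C V)
    (hv : ∀ T : PosReal, cesaro K g T ∈ C) (hw : ∀ l : PosReal, abel K g l ∈ C)
    (hvDPP : CesaroWeakDPP g C V hv) (hwDPP : AbelWeakDPP g C V hw) {f : Ω → ℝ}
    (hf : TendstoUniformly (fun l => (abelValue g C V hw l).1) f toZero) :
    TendstoUniformly (fun T => (cesaroValue g C V hv T).1) f atTop := by
  rw [Metric.tendstoUniformly_iff] at hf ⊢
  intro η hη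
  obtain ⟨δ, hδ, hδ1, hδη⟩ : ∃ δ : ℝ, 0 < δ ∧ δ ≤ 1 ∧ 100 * δ < η :=
    ⟨min 1 (η / 200), by positivity, min_le_left _ _, by linarith [min_le_right 1 (η / 200)]⟩
  have : Nonempty PosReal := ⟨⟨1, one_pos⟩⟩
  obtain ⟨s, hs, hsub⟩ := mem_comap.1 (hf (δ ^ 2) (by positivity))
  obtain ⟨b, hb, hbs⟩ := mem_nhdsGT_iff_exists_Ioo_subset.1 hs
  have hb0 : 0 < b := hb
  obtain ⟨R, hR⟩ := exists_nat_gt (1 / b)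
  have hW : ∀ T : ℕ+, R ≤ (T : ℕ) → ∀ l : PosReal, (l : ℝ) = 1 / (T : ℕ) →
      ∀ ω, |(abelValue g C V hw l).1 ω - f ω| ≤ δ ^ 2 := by
    intro T hT l hl ω
    have hRT : (R : ℝ) ≤ (T : ℕ) := by exact_mod_cast hT
    have hlb : (l : ℝ) < b := by
      rw [hl, one_div_lt (Nat.cast_pos.2 T.pos) hb0]
      linarith
    have := hsub (show l ∈ Subtype.val ⁻¹' s from hbs ⟨l.2, hlb⟩) ω
    rw [abs_sub_comm]
    exact this.le
  have hU01 : ∀ T ω, (cesaroValue g C V hv T).1 ω ∈ Set.Icc (0 : ℝ) 1 := fun T =>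
    hV.mem_Icc hC (cesaro_mem_Icc hg hmeas T)
  have hW01 : ∀ l ω, (abelValue g C V hw l).1 ω ∈ Set.Icc (0 : ℝ) 1 := fun l =>
    hV.mem_Icc hC (abel_mem_Icc hg l)
  have hδ2 : δ ^ 2 ≤ δ := by nlinarith
  have hρ0 : 0 ≤ 1 - δ / 2 := by linarith
  -- `88δ` is the fixed point of `d ↦ (1 - δ/2) d + 44δ^2`. The threshold `M` depends on `k`, which
  -- is harmless since a single `k` is used.
  have iter : ∀ k : ℕ, ∃ M : ℕ, ∀ T : ℕ+, M ≤ (T : ℕ) →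
      ∀ ω, |(cesaroValue g C V hv (natPos T)).1 ω - f ω| ≤ 88 * δ + (1 - δ / 2) ^ k * 2 := by
    intro k
    induction k with
    | zero =>
      refine ⟨R, fun T hT ω => ?_⟩
      have a1 := abs_le.1 (hW T hT ⟨1 / (T : ℕ), one_div_pos.2 (Nat.cast_pos.2 T.pos)⟩ rfl ω)
      have a2 := hU01 (natPos T) ω
      have a3 := hW01 ⟨1 / (T : ℕ), one_div_pos.2 (Nat.cast_pos.2 T.pos)⟩ ω
      exact abs_le.2 ⟨by linarith [a1.1, a1.2, a2.1, a2.2, a3.1, a3.2],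
        by linarith [a1.1, a1.2, a2.1, a2.2, a3.1, a3.2]⟩
    | succ k ih =>
      obtain ⟨M, hM⟩ := ih
      obtain ⟨M', hM'⟩ := exists_cesaroValue_improvement hg hmeas hC hV hv hw hvDPP hwDPP hδ hδ1
        (R := R + M) (fun T hT => hW T (by omega))
        (d := 88 * δ + (1 - δ / 2) ^ k * 2) (by positivity) (fun T hT => hM T (by omega))
      refine ⟨M', fun T hT ω => (hM' T hT ω).trans (le_of_eq ?_)⟩
      ring
  obtain ⟨k, hk⟩ := exists_pow_lt_of_lt_one hδ (by linarith : 1 - δ / 2 < 1)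
  obtain ⟨M, hM⟩ := iter k
  obtain ⟨T₀, hT₀⟩ := exists_nat_gt (M + 1 / δ)
  have hδi : 0 < 1 / δ := by positivity
  have hM0 : (0 : ℝ) ≤ M := Nat.cast_nonneg M
  refine eventually_atTop.2 ⟨⟨T₀, by linarith⟩, fun S hS ω => ?_⟩
  have hS0 : (0 : ℝ) < S := S.2
  have hTS : (T₀ : ℝ) ≤ S := Subtype.coe_le_coe.2 hS
  -- Rounding to an integer horizon costs at most `δ`, for a total below `91δ < η`.
  let T : ℕ+ := ⟨⌈(S : ℝ)⌉₊, Nat.ceil_pos.2 hS0⟩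
  have h1 : (S : ℝ) ≤ (T : ℕ) := Nat.le_ceil _
  have h2 : ((T : ℕ) : ℝ) < S + 1 := Nat.ceil_lt_add_one hS0.le
  have hT0 : (0 : ℝ) < (T : ℕ) := Nat.cast_pos.2 T.pos
  have h3 : 1 - (S : ℝ) / (T : ℕ) ≤ δ := by
    have : 1 - (S : ℝ) / (T : ℕ) = ((T : ℕ) - S) / (T : ℕ) := by field_simp
    rw [this, div_le_iff₀ hT0]
    have : 1 ≤ (T : ℕ) * δ := by rw [← div_le_iff₀ hδ]; linarith
    linarith
  have a1 := abs_le.1 (hM T (by exact_mod_cast (by linarith : (M : ℝ) ≤ (T : ℕ))) ω)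
  have a2 := abs_le.1 (hV.abs_sub_le hC (c₁ := ⟨_, hv S⟩) (c₂ := ⟨_, hv (natPos T)⟩)
    (fun z => (abs_cesaro_sub_le hg hmeas (S := S) (T := natPos T) h1 z).trans h3) ω)
  rw [Real.dist_eq]
  unfold cesaroValue at a1 ⊢
  exact abs_lt.2 ⟨by linarith [a1.1, a1.2, a2.1, a2.2], by linarith [a1.1, a1.2, a2.1, a2.2]⟩

end Values

end GameValue

theorem theorem2 {Ω : Type*} [Nonempty Ω] (K : Set (ℝ≥0 → Ω)) (hK : K.Nonempty)
    (g : Ω → ℝ) (hg : ∀ ω, g ω ∈ Set.Icc (0 : ℝ) 1)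
    (hmeas : ∀ z ∈ K, Measurable (fun t : ℝ≥0 => g (z t)))
    (C : Set (K → ℝ)) (hC : GameValue.IsAffineClosed C)
    (V : C → GameValue.boundedMaps Ω) (hV : GameValue.IsGameValueMap C V)
    (hv : ∀ T : GameValue.PosReal, GameValue.cesaro K g T ∈ C)
    (hw : ∀ lam : GameValue.PosReal, GameValue.abel K g lam ∈ C)
    (hvDPP : GameValue.CesaroWeakDPP g C V hv)
    (hwDPP : GameValue.AbelWeakDPP g C V hw) :
    ((∃ f : Ω → ℝ, TendstoUniformly
          (fun T => (GameValue.cesaroValue g C V hv T).1) f atTop) ↔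
      (∃ f : Ω → ℝ, TendstoUniformly
          (fun lam => (GameValue.abelValue g C V hw lam).1) f GameValue.toZero)) ∧
    (((∃ f : Ω → ℝ, TendstoUniformly
          (fun T => (GameValue.cesaroValue g C V hv T).1) f atTop) ∨
      (∃ f : Ω → ℝ, TendstoUniformly
          (fun lam => (GameValue.abelValue g C V hw lam).1) f GameValue.toZero)) →
      ∀ ω, ∃ L : ℝ,
        Tendsto (fun T => (GameValue.cesaroValue g C V hv T).1 ω) atTop (𝓝 L) ∧
        Tendsto (fun lam => (GameValue.abelValue g C V hw lam).1 ω) GameValue.toZero (𝓝 L)) := by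
  have hca := fun {f : Ω → ℝ} => GameValue.abel_tendsto_of_cesaro_tendsto (f := f) hg hmeas hC hV
    hv hw hvDPP hwDPP
  have hac := fun {f : Ω → ℝ} => GameValue.cesaro_tendsto_of_abel_tendsto (f := f) hg hmeas hC hV
    hv hw hvDPP hwDPP
  refine ⟨⟨fun ⟨f, hf⟩ => ⟨f, hca hf⟩, fun ⟨f, hf⟩ => ⟨f, hac hf⟩⟩, ?_⟩
  rintro (⟨f, hf⟩ | ⟨f, hf⟩) ω
  · exact ⟨f ω, hf.tendsto_at ω, (hca hf).tendsto_at ω⟩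
  · exact ⟨f ω, (hac hf).tendsto_at ω, hf.tendsto_at ω⟩
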